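/- Let $\mathcal C$ be a braided monoidal category with tensor product $\otimes$, unit object $K$ and braiding $c$, in which every idempotent splits. (Associativity and unit constraints are suppressed, and an object also denotes its identity morphism.) A weak Hopf quasigroup in $\mathcal C$ is an object $H$ with a unit $\eta_H:K\to H$ and a product $\mu_H:H\otimes H\to H$ satisfying $\mu_H\circ(\eta_H\otimes H)=id_H=\mu_H\circ(H\otimes\eta_H)$ ($\mu_H$ need not be associative), and a coassociative counital comonoid structure $(\varepsilon_H,\delta_H)$, such that (a1) $\delta_H\circ\mu_H=(\mu_H\otimes\mu_H)\circ(H\otimes c_{H,H}\otimes H)\circ(\delta_H\otimes\delta_H)$; (a2) $\varepsilon_H\circ\mu_H\circ(\mu_H\otimes H)=\varepsilon_H\circ\mu_H\circ(H\otimes\mu_H)=((\varepsilon_H\circ\mu_H)\otimes(\varepsilon_H\circ\mu_H))\circ(H\otimes\delta_H\otimes H)=((\varepsilon_H\circ\mu_H)\otimes(\varepsilon_H\circ\mu_H))\circ(H\otimes(c_{H,H}^{-1}\circ\delta_H)\otimes H)$; (a3) $(\delta_H\otimes H)\circ\delta_H\circ\eta_H=(H\otimes\mu_H\otimes H)\circ((\delta_H\circ\eta_H)\otimes(\delta_H\circ\eta_H))=(H\otimes(\mu_H\circ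 c_{H,H}^{-1})\otimes H)\circ((\delta_H\circ\eta_H)\otimes(\delta_H\circ\eta_H))$; (a4) there is $\lambda_H:H\to H$ (the antipode) such that, writing $f*g=\mu_H\circ(f\otimes g)\circ\delta_H$, $\Pi^L_H=id_H*\lambda_H$ and $\Pi^R_H=\lambda_H*id_H$: $\Pi_H^L=((\varepsilon_H\circ\mu_H)\otimes H)\circ(H\otimes c_{H,H})\circ((\delta_H\circ\eta_H)\otimes H)$; $\Pi_H^R=(H\otimes(\varepsilon_H\circ\mu_H))\circ(c_{H,H}\otimes H)\circ(H\otimes(\delta_H\circ\eta_H))$; $\lambda_H*\Pi_H^L=\Pi_H^R*\lambda_H=\lambda_H$; $\mu_H\circ(\lambda_H\otimes\mu_H)\circ(\delta_H\otimes H)=\mu_H\circ(\Pi_H^R\otimes H)$; $\mu_H\circ(H\otimes\mu_H)\circ(H\otimes\lambda_H\otimes H)\circ(\delta_H\otimes H)=\mu_H\circ(\Pi_H^L\otimes H)$; $\mu_H\circ(\mu_H\otimes\lambda_H)\circ(H\otimes\delta_H)=\mu_H\circ(H\otimes\Pi_H^L)$; $\mu_H\circ(\mu_H\otimes H)\circ(H\otimes\lambda_H\otimes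 H)\circ(H\otimes\delta_H)=\mu_H\circ(H\otimes\Pi_H^R)$. A (right-right) $H$-Hopf module is a right $H$-comodule $(M,\rho_M)$ with a morphism $\phi_M:M\otimes H\to M$ such that $\phi_M\circ(M\otimes\eta_H)=id_M$; $\rho_M\circ\phi_M=(\phi_M\otimes\mu_H)\circ(M\otimes c_{H,H}\otimes H)\circ(\rho_M\otimes\delta_H)$; $\phi_M\circ(\phi_M\otimes\lambda_H)\circ(M\otimes\delta_H)=\phi_M\circ(M\otimes\Pi_H^L)$; $\phi_M\circ(\phi_M\otimes H)\circ(M\otimes\lambda_H\otimes H)\circ(M\otimes\delta_H)=\phi_M\circ(M\otimes\Pi_H^R)$; $\phi_M\circ(\phi_M\otimes H)\circ(M\otimes\Pi_H^L\otimes H)\circ(M\otimes\delta_H)=\phi_M$. Put $q_M=\phi_M\circ(M\otimes\lambda_H)\circ\rho_M$ and $\phi_M^{\alpha_M}=\phi_M\circ(q_M\otimes\mu_H)\circ(\rho_M\otimes H)$. A morphism of Hopf modules $g:M\to T$ is a morphism of right $H$-comodules with $\phi_T^{\alpha_T}\circ(g\otimes H)=g\circ\phi_M^{\alpha_M}$.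 **Proposition 3.8.** Let $H$ be a weak Hopf quasigroup in $\mathcal C$. Then $\Pi^L_H$ is idempotent, and $q_M$ is idempotent for every $H$-Hopf module $M$. Choose a splitting $\Pi_H^L=i_L\circ p_L$, $p_L\circ i_L=id_{H_L}$, through an object $H_L$. Let $\mathcal{SM}^H_H$ be the full subcategory of the strong Hopf modules, those with $$\phi_M\circ((\phi_M\circ(M\otimes i_L))\otimes H)=\phi_M\circ(M\otimes(\mu_H\circ(i_L\otimes H))),$$ and for every strong Hopf module $M$ choose a splitting $q_M=i_M\circ p_M$, $p_M\circ i_M=id_{M^{coH}}$, through an object $M^{coH}$. Then, for all such choices: 1. $H_L$ is a monoid with unit $p_L\circ\eta_H$ and product $p_L\circ\mu_H\circ(i_L\otimes i_L)$; let $\mathcal C_{H_L}$ be the category of right $H_L$-modules; 2. for every strong Hopf module $M$, the morphism $\psi_{M^{coH}}=p_M\circ\phi_M\circ(i_M\otimes i_L)$ is a right $H_L$-module structure on $M^{coH}$; 3. for every morphism $g:M\to T$ in $\mathcal{SM}^H_H$ there is a unique morphism $g^{coH}:M^{coH}\to T^{coH}$ in $\mathcal C$ with $i_T\circ g^{coH}=g\circ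 i_M$; 4. there is a functor $G:\mathcal{SM}^H_H\to\mathcal C_{H_L}$ with $G(M)=(M^{coH},\psi_{M^{coH}})$ on objects and $G(g)=g^{coH}$ on morphisms (in particular $g^{coH}$ is a morphism of right $H_L$-modules). -/

import Mathlib

open CategoryTheory MonoidalCategory BraidedCategory ComonObj

universe v u

/-- A splitting `e = i ∘ p`, `p ∘ i = id` of an endomorphism `e`; the object `obj` is the image
of `e`. -/
structure Splitting {C : Type u} [Category.{v} C] {Y : C} (e : Y ⟶ Y) where
  obj : C
  i : obj ⟶ Y
  p : Y ⟶ obj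
  p_i : p ≫ i = e
  i_p : i ≫ p = 𝟙 obj

section Definitions

variable {C : Type u} [Category.{v} C] [MonoidalCategory C]

/-- The convolution product `f ∗ g = μ ∘ (f ⊗ g) ∘ δ` of endomorphisms of a comonoid with a
(not necessarily associative) product. -/
def convolution {X : C} [ComonObj X] (mul : X ⊗ X ⟶ X) (f g : X ⟶ X) : X ⟶ X :=
  Δ[X] ≫ (f ⊗ₘ g) ≫ mul

/-- Weak Hopf quasigroups in a braided monoidal category. In the axioms `⊗≫` is composition
with the canonical associativity and unit isomorphisms inserted. -/
structure WeakHopfQuasigroup (C : Type u) [Category.{v} C] [MonoidalCategory C]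
    [BraidedCategory C] where
  X : C
  /-- the comonoid structure -/
  [comon : ComonObj X]
  /-- the unit -/
  one : 𝟙_ C ⟶ X
  /-- the product, not assumed to be associative -/
  mul : X ⊗ X ⟶ X
  /-- the antipode -/
  antipode : X ⟶ X
  one_mul : one ▷ X ≫ mul = (λ_ X).hom
  mul_one : X ◁ one ≫ mul = (ρ_ X).hom
  /-- (a1) -/
  mul_comul : mul ≫ Δ[X] = (Δ[X] ⊗ₘ Δ[X]) ≫ tensorμ X X X X ≫ (mul ⊗ₘ mul)
  /-- (a2), first equality -/
  counit_mul_assoc : mul ▷ X ≫ mul ≫ ε[X] = (α_ X X X).hom ≫ X ◁ mul ≫ mul ≫ ε[X]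
  /-- (a2), second equality -/
  counit_mul_comul : mul ▷ X ≫ mul ≫ ε[X] =
    (X ◁ Δ[X]) ▷ X ⊗≫ ((mul ≫ ε[X]) ⊗ₘ (mul ≫ ε[X])) ≫ (λ_ (𝟙_ C)).hom
  /-- (a2), third equality -/
  counit_mul_comul_braid : mul ▷ X ≫ mul ≫ ε[X] =
    (X ◁ (Δ[X] ≫ (β_ X X).inv)) ▷ X ⊗≫ ((mul ≫ ε[X]) ⊗ₘ (mul ≫ ε[X])) ≫ (λ_ (𝟙_ C)).hom
  /-- (a3), first equality -/
  one_comul_comul : one ≫ Δ[X] ≫ Δ[X] ▷ X =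
    (λ_ (𝟙_ C)).inv ≫ ((one ≫ Δ[X]) ⊗ₘ (one ≫ Δ[X])) ⊗≫ (X ◁ mul) ▷ X
  /-- (a3), second equality -/
  one_comul_comul_braid : one ≫ Δ[X] ≫ Δ[X] ▷ X =
    (λ_ (𝟙_ C)).inv ≫ ((one ≫ Δ[X]) ⊗ₘ (one ≫ Δ[X])) ⊗≫ (X ◁ ((β_ X X).inv ≫ mul)) ▷ X
  /-- (a4-1) -/
  target_eq : convolution mul (𝟙 X) antipode =
    (λ_ X).inv ≫ (one ≫ Δ[X]) ▷ X ⊗≫ X ◁ (β_ X X).hom ⊗≫ (mul ≫ ε[X]) ▷ X ≫ (λ_ X).hom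
  /-- (a4-2) -/
  source_eq : convolution mul antipode (𝟙 X) =
    (ρ_ X).inv ≫ X ◁ (one ≫ Δ[X]) ⊗≫ (β_ X X).hom ▷ X ⊗≫ X ◁ (mul ≫ ε[X]) ≫ (ρ_ X).hom
  /-- (a4-3), first equality -/
  antipode_target : convolution mul antipode (convolution mul (𝟙 X) antipode) = antipode
  /-- (a4-3), second equality -/
  source_antipode : convolution mul (convolution mul antipode (𝟙 X)) antipode = antipode
  /-- (a4-4) -/
  antipode_mul : Δ[X] ▷ X ⊗≫ (antipode ⊗ₘ mul) ≫ mul =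
    convolution mul antipode (𝟙 X) ▷ X ≫ mul
  /-- (a4-5) -/
  mul_antipode_mul : Δ[X] ▷ X ⊗≫ X ◁ (antipode ▷ X) ≫ X ◁ mul ≫ mul =
    convolution mul (𝟙 X) antipode ▷ X ≫ mul
  /-- (a4-6) -/
  mul_mul_antipode : X ◁ Δ[X] ⊗≫ (mul ⊗ₘ antipode) ≫ mul =
    X ◁ convolution mul (𝟙 X) antipode ≫ mul
  /-- (a4-7) -/
  mul_antipode_mul' : X ◁ Δ[X] ⊗≫ (X ◁ antipode) ▷ X ≫ mul ▷ X ≫ mul =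
    X ◁ convolution mul antipode (𝟙 X) ≫ mul

attribute [instance] WeakHopfQuasigroup.comon

variable [BraidedCategory C]

/-- The target morphism `Π^L = id ∗ λ`. -/
def WeakHopfQuasigroup.target (H : WeakHopfQuasigroup C) : H.X ⟶ H.X :=
  convolution H.mul (𝟙 H.X) H.antipode

/-- The source morphism `Π^R = λ ∗ id`. -/
def WeakHopfQuasigroup.source (H : WeakHopfQuasigroup C) : H.X ⟶ H.X :=
  convolution H.mul H.antipode (𝟙 H.X)

/-- Right-right `H`-Hopf modules. -/
structure HopfModule (H : WeakHopfQuasigroup C) where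
  X : C
  /-- `φ_M` -/
  act : X ⊗ H.X ⟶ X
  /-- `ρ_M` -/
  coact : X ⟶ X ⊗ H.X
  /-- (b1), counit -/
  coact_counit : coact ≫ X ◁ ε[H.X] = (ρ_ X).inv
  /-- (b1), coassociativity -/
  coact_coact : coact ≫ coact ▷ H.X = coact ≫ X ◁ Δ[H.X] ≫ (α_ X H.X H.X).inv
  /-- (b2-1) -/
  act_one : X ◁ H.one ≫ act = (ρ_ X).hom
  /-- (b2-2) -/
  act_coact : act ≫ coact = (coact ⊗ₘ Δ[H.X]) ≫ tensorμ X H.X H.X H.X ≫ (act ⊗ₘ H.mul)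
  /-- (b3) -/
  act_act_antipode : X ◁ Δ[H.X] ⊗≫ (act ⊗ₘ H.antipode) ≫ act = X ◁ H.target ≫ act
  /-- (b4) -/
  act_antipode_act : X ◁ Δ[H.X] ⊗≫ (X ◁ H.antipode) ▷ H.X ≫ act ▷ H.X ≫ act =
    X ◁ H.source ≫ act
  /-- (b5) -/
  act_target_act : X ◁ Δ[H.X] ⊗≫ (X ◁ H.target) ▷ H.X ≫ act ▷ H.X ≫ act = act

namespace HopfModule

variable {H : WeakHopfQuasigroup C}

/-- `q_M = φ_M ∘ (M ⊗ λ_H) ∘ ρ_M`; its image is the object of coinvariants `M^{coH}`. -/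
def q (M : HopfModule H) : M.X ⟶ M.X :=
  M.coact ≫ M.X ◁ H.antipode ≫ M.act

/-- The action `φ_M^{α_M}`, given by the closed formula `φ_M ∘ (q_M ⊗ μ_H) ∘ (ρ_M ⊗ H)`. By
`HopfModule.alphaAct_eq` below it is the action of `M^{coH} × H` transported along the
isomorphism `α_M : M ⟶ M^{coH} × H`, for any choice of the images. -/
def alphaAct (M : HopfModule H) : M.X ⊗ H.X ⟶ M.X :=
  M.coact ▷ H.X ⊗≫ (M.q ⊗ₘ H.mul) ≫ M.act

/-- `ω_M : M^{coH} ⊗ H ⟶ M`. -/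
def omega (M : HopfModule H) (S : Splitting M.q) : S.obj ⊗ H.X ⟶ M.X :=
  S.i ▷ H.X ≫ M.act

/-- `ω'_M : M ⟶ M^{coH} ⊗ H`. -/
def omega' (M : HopfModule H) (S : Splitting M.q) : M.X ⟶ S.obj ⊗ H.X :=
  M.coact ≫ S.p ▷ H.X

/-- `∇_M = ω'_M ∘ ω_M`; its image is `M^{coH} × H`. -/
def nabla (M : HopfModule H) (S : Splitting M.q) : S.obj ⊗ H.X ⟶ S.obj ⊗ H.X :=
  M.omega S ≫ M.omega' S

/-- `α_M : M ⟶ M^{coH} × H`. -/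
def alpha (M : HopfModule H) (S : Splitting M.q) (T : Splitting (M.nabla S)) : M.X ⟶ T.obj :=
  M.omega' S ≫ T.p

/-- The inverse of `α_M`. -/
def alphaInv (M : HopfModule H) (S : Splitting M.q) (T : Splitting (M.nabla S)) :
    T.obj ⟶ M.X :=
  T.i ≫ M.omega S

/-- The action `φ_{M^{coH} × H}`. -/
def prodAct (M : HopfModule H) (S : Splitting M.q) (T : Splitting (M.nabla S)) :
    T.obj ⊗ H.X ⟶ T.obj :=
  T.i ▷ H.X ≫ (α_ S.obj H.X H.X).hom ≫ S.obj ◁ H.mul ≫ T.p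

theorem coact_source_act (M : HopfModule H) : M.coact ≫ M.X ◁ H.source ≫ M.act = 𝟙 M.X := by
  have h1 : M.X ◁ H.one ≫ M.act ≫ M.coact ≫ M.X ◁ ε[H.X] = (ρ_ M.X).hom ≫ (ρ_ M.X).inv := by
    rw [M.coact_counit, ← Category.assoc, M.act_one]
  rw [reassoc_of% M.act_coact] at h1
  have h2 : M.X ◁ H.one ≫ (M.coact ⊗ₘ Δ[H.X]) ≫ tensorμ M.X H.X H.X H.X ≫
      (M.act ⊗ₘ H.mul) ≫ M.X ◁ ε[H.X] =
      (ρ_ M.X).hom ≫ M.coact ≫ M.X ◁ H.source ≫ M.act ≫ (ρ_ M.X).inv := by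
    have h3 : H.source = _ := H.source_eq
    rw [h3]
    simp only [tensorμ, MonoidalCategory.tensorHom_def, monoidalComp, Category.assoc]
    rw [whisker_exchange_assoc M.coact H.one, ← whisker_exchange_assoc M.act H.mul,
      ← whisker_exchange M.act]
    monoidal
  have h4 := h2.symm.trans h1
  rw [← cancel_epi (ρ_ M.X).hom, ← cancel_mono (ρ_ M.X).inv]
  simpa using h4

theorem omega'_omega (M : HopfModule H) (S : Splitting M.q) :
    M.omega' S ≫ M.omega S = 𝟙 M.X := by
  rw [← M.coact_source_act, ← M.act_antipode_act]
  simp only [omega, omega', Category.assoc, monoidalComp]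
  rw [← comp_whiskerRight_assoc, S.p_i, q]
  simp only [comp_whiskerRight, Category.assoc]
  rw [reassoc_of% M.coact_coact]
  monoidal

theorem alpha_alphaInv (M : HopfModule H) (S : Splitting M.q) (T : Splitting (M.nabla S)) :
    M.alpha S T ≫ M.alphaInv S T = 𝟙 M.X := by
  have h := M.omega'_omega S
  have e := T.p_i
  simp only [alpha, alphaInv, Category.assoc]
  rw [reassoc_of% e, nabla, Category.assoc, h, Category.comp_id, h]

theorem alphaInv_alpha (M : HopfModule H) (S : Splitting M.q) (T : Splitting (M.nabla S)) :
    M.alphaInv S T ≫ M.alpha S T = 𝟙 T.obj := by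
  have e : M.omega S ≫ M.omega' S = T.p ≫ T.i := T.p_i.symm
  simp only [alpha, alphaInv, Category.assoc]
  rw [reassoc_of% e, T.i_p, reassoc_of% T.i_p]

/-- `φ_M^{α_M} = α_M⁻¹ ∘ φ_{M^{coH} × H} ∘ (α_M ⊗ H)`. -/
theorem alphaAct_eq (M : HopfModule H) (S : Splitting M.q) (T : Splitting (M.nabla S)) :
    M.alpha S T ▷ H.X ≫ M.prodAct S T ≫ M.alphaInv S T = M.alphaAct := by
  have e : T.p ≫ T.i = M.omega S ≫ M.omega' S := T.p_i
  have h := M.omega'_omega S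
  have h1 : M.omega' S ≫ T.p ≫ T.i = M.omega' S := by rw [e, reassoc_of% h]
  have h2 : T.p ≫ T.i ≫ M.omega S = M.omega S := by rw [reassoc_of% e, h, Category.comp_id]
  simp only [alpha, alphaInv, prodAct, Category.assoc, h2]
  rw [← comp_whiskerRight_assoc, Category.assoc, h1, omega, whisker_exchange_assoc]
  simp only [omega', alphaAct, MonoidalCategory.tensorHom_def, monoidalComp, ← S.p_i]
  monoidal

/-- Morphisms of Hopf modules: right `H`-colinear and `H`-quasilinear morphisms. -/
@[ext]
structure Hom (M N : HopfModule H) where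
  hom : M.X ⟶ N.X
  colinear : hom ≫ N.coact = M.coact ≫ hom ▷ H.X
  quasilinear : hom ▷ H.X ≫ N.alphaAct = M.alphaAct ≫ hom

/-- The category of right-right `H`-Hopf modules. -/
instance : Category (HopfModule H) where
  Hom := Hom
  id M := ⟨𝟙 M.X, by simp, by simp⟩
  comp f g := ⟨f.hom ≫ g.hom,
    by rw [Category.assoc, g.colinear, ← Category.assoc, f.colinear]; simp,
    by rw [comp_whiskerRight, Category.assoc, g.quasilinear, ← Category.assoc, f.quasilinear,
      Category.assoc]⟩

/-- Strong Hopf modules: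
`φ_M ∘ ((φ_M ∘ (M ⊗ i_L)) ⊗ H) = φ_M ∘ (M ⊗ (μ_H ∘ (i_L ⊗ H)))`. -/
def IsStrong (L : Splitting H.target) : ObjectProperty (HopfModule H) := fun M =>
  (M.X ◁ L.i ≫ M.act) ▷ H.X ≫ M.act =
    (α_ M.X L.obj H.X).hom ≫ M.X ◁ (L.i ▷ H.X ≫ H.mul) ≫ M.act

/-- The right `H_L`-action `p_M ∘ φ_M ∘ (i_M ⊗ i_L)` on `M^{coH}`. -/
def coinvAct (M : HopfModule H) (L : Splitting H.target) (S : Splitting M.q) :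
    S.obj ⊗ L.obj ⟶ S.obj :=
  (S.i ⊗ₘ L.i) ≫ M.act ≫ S.p

end HopfModule

/-- The category of strong right-right `H`-Hopf modules, a full subcategory of the category of
Hopf modules. -/
abbrev StrongHopfModule (H : WeakHopfQuasigroup C) (L : Splitting H.target) :=
  (HopfModule.IsStrong (H := H) L).FullSubcategory

end Definitions

section RightModules

variable {C : Type u} [Category.{v} C] [MonoidalCategory C]

/-- `ψ : N ⊗ B ⟶ N` is a right action of the monoid `B` on `N`. -/
structure IsRightAction (B : C) [MonObj B] (N : C) (ψ : N ⊗ B ⟶ N) : Prop where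
  act_one : N ◁ MonObj.one ≫ ψ = (ρ_ N).hom
  act_mul : (α_ N B B).hom ≫ N ◁ MonObj.mul ≫ ψ = ψ ▷ B ≫ ψ

/-- Right modules over a monoid `B`. -/
structure RightModule (B : C) [MonObj B] where
  X : C
  act : X ⊗ B ⟶ X
  isRightAction : IsRightAction B X act

namespace RightModule

variable {B : C} [MonObj B]

/-- Morphisms of right modules. -/
@[ext]
structure Hom (M N : RightModule B) where
  hom : M.X ⟶ N.X
  linear : hom ▷ B ≫ N.act = M.act ≫ hom

/-- The category of right `B`-modules. -/
instance : Category (RightModule B) where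
  Hom := Hom
  id M := ⟨𝟙 M.X, by simp⟩
  comp f g := ⟨f.hom ≫ g.hom, by
    rw [comp_whiskerRight, Category.assoc, g.linear, ← Category.assoc, f.linear, Category.assoc]⟩

end RightModule

end RightModules

/-! In element notation, with braidings suppressed, write `Π` for `target`. The product of `H` is
not associative, but elements of `H_L` on the left do associate. By (a3) the second leg of `δ(1)` is
fixed by `Π` and by `barSource`, so these two maps have the same image and `δ(z) = z 1₁ ⊗ 1₂` for
`z` in it. With (a1) and (a2) this yields `z y = ε(z y₁) y₂` and `δ(z y) = z y₁ ⊗ y₂`. Associativity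
is then needed only under `ε`, where (a2) grants it: this is `target_mul_mul`, which together with
`target_mul_target` makes `H_L` a monoid.

For a Hopf module, call `n` coinvariant when `ρ(n)` lies in `M ⊗ H_L`. The image of `q_M` is
coinvariant because `ρ(q(m))` can be rewritten so that its second leg is the second leg of some
`δ(Π(x))` (`antipodeComul_eq`). Conversely, coinvariance gives `ρ(n h) = n h₁ ⊗ h₂`, hence `q(n h) =
n Π(h)` and `q(n) = n`. So `q_M` is idempotent, its image is stable under `H_L`, and colinear maps
preserve it. Strongness supplies the associativity of the `H_L`-action. It also makes `φ_M^{α_M}`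
agree with `φ_M` on coinvariants (`IsCoinvariant.alphaAct`), so that quasilinear maps induce
`H_L`-linear ones. -/

theorem Splitting.i_comp {D : Type u} [Category.{v} D] {Y : D} {e : Y ⟶ Y} (S : Splitting e) :
    S.i ≫ e = S.i := by
  have h := S.i ≫= S.p_i
  rw [reassoc_of% S.i_p] at h
  exact h.symm

theorem Splitting.hom_ext {D : Type u} [Category.{v} D] {Y W : D} {e : Y ⟶ Y} (S : Splitting e)
    {f g : W ⟶ S.obj} (h : f ≫ S.i = g ≫ S.i) : f = g := by
  simpa [S.i_p] using h =≫ S.p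

section

variable {C : Type u} [Category.{v} C] [MonoidalCategory C] [BraidedCategory C]

theorem braiding_tensor_left_comp (A B Z : C) : (β_ (A ⊗ B) Z).hom =
    𝟙 _ ⊗≫ A ◁ (β_ B Z).hom ⊗≫ (β_ A Z).hom ▷ B ⊗≫ 𝟙 _ := by
  simp [monoidalComp]

theorem braiding_tensor_right_comp (Z A B : C) : (β_ Z (A ⊗ B)).hom =
    𝟙 _ ⊗≫ (β_ Z A).hom ▷ B ⊗≫ A ◁ (β_ Z B).hom ⊗≫ 𝟙 _ := by
  simp [monoidalComp]

/-- Pulling a strand through a cup `u : 𝟙 ⟶ A ⊗ B`. -/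
theorem cup_braiding {A B : C} (u : 𝟙_ C ⟶ A ⊗ B) (Z : C) :
    (λ_ Z).inv ≫ u ▷ Z ⊗≫ A ◁ (β_ B Z).hom =
      (ρ_ Z).inv ≫ Z ◁ u ⊗≫ (β_ A Z).inv ▷ B ⊗≫ 𝟙 (A ⊗ Z ⊗ B) := by
  have h := braiding_naturality_left u Z
  rw [braiding_tensorUnit_left, braiding_tensor_left_comp] at h
  calc _ = (λ_ Z).inv ≫ u ▷ Z ⊗≫ A ◁ (β_ B Z).hom ⊗≫
        ((β_ A Z).hom ≫ (β_ A Z).inv) ▷ B ⊗≫ 𝟙 (A ⊗ Z ⊗ B) := by rw [Iso.hom_inv_id]; monoidal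
    _ = (λ_ Z).inv ≫ (u ▷ Z ≫ 𝟙 _ ⊗≫ A ◁ (β_ B Z).hom ⊗≫ (β_ A Z).hom ▷ B ⊗≫ 𝟙 (Z ⊗ A ⊗ B)) ⊗≫
      (β_ A Z).inv ▷ B ⊗≫ 𝟙 (A ⊗ Z ⊗ B) := by monoidal
    _ = _ := by rw [h]; monoidal

/-! ### The coproduct of the unit and the idempotent `Π`. -/

namespace WeakHopfQuasigroup
variable (H : WeakHopfQuasigroup C)

/-- `x ↦ f (x ⊗ 1₁) ⊗ 1₂`. -/
def coactOne {Y : C} (f : H.X ⊗ H.X ⟶ Y) : H.X ⟶ Y ⊗ H.X :=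
  (ρ_ H.X).inv ≫ H.X ◁ (H.one ≫ Δ[H.X]) ⊗≫ f ▷ H.X

/-- `x ↦ ε (x 1₁) 1₂`. -/
def barSource : H.X ⟶ H.X :=
  H.coactOne (H.mul ≫ ε[H.X]) ≫ (λ_ H.X).hom

/-- Pulling the strand through `δ(1)` trades the braiding for its inverse. This puts `Π` in the same
shape as `barSource` and matches the second form of (a3). -/
theorem target_eq_coactOne : H.target =
    H.coactOne ((β_ H.X H.X).inv ≫ H.mul ≫ ε[H.X]) ≫ (λ_ H.X).hom := by
  have h : H.target = _ := H.target_eq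
  calc H.target = ((λ_ H.X).inv ≫ (H.one ≫ Δ[H.X]) ▷ H.X ⊗≫ H.X ◁ (β_ H.X H.X).hom) ⊗≫
        (H.mul ≫ ε[H.X]) ▷ H.X ⊗≫ 𝟙 H.X := by rw [h]; monoidal
    _ = _ := by rw [cup_braiding, coactOne]; monoidal

theorem coactOne_comp {Y Z : C} (f : H.X ⊗ H.X ⟶ Y) (g : Y ⟶ Z) :
    H.coactOne (f ≫ g) = H.coactOne f ≫ g ▷ H.X := by
  simp only [coactOne]; monoidal

theorem one_comul_coactOne_mul :
    H.one ≫ Δ[H.X] ≫ H.X ◁ Δ[H.X] = H.one ≫ Δ[H.X] ≫ H.X ◁ H.coactOne H.mul := by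
  rw [comul_assoc, reassoc_of% H.one_comul_comul, coactOne, MonoidalCategory.tensorHom_def']
  calc _ = (λ_ (𝟙_ C)).inv ≫ (𝟙_ C ◁ (H.one ≫ Δ[H.X]) ≫ (H.one ≫ Δ[H.X]) ▷ (H.X ⊗ H.X)) ⊗≫
    (H.X ◁ H.mul) ▷ H.X ⊗≫ 𝟙 _ := by monoidal
    _ = _ := by rw [whisker_exchange]; monoidal

theorem one_comul_coactOne_mul_op :
    H.one ≫ Δ[H.X] ≫ H.X ◁ Δ[H.X] =
      H.one ≫ Δ[H.X] ≫ H.X ◁ H.coactOne ((β_ H.X H.X).inv ≫ H.mul) := by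
  rw [comul_assoc, reassoc_of% H.one_comul_comul_braid, coactOne,
    MonoidalCategory.tensorHom_def']
  calc _ = (λ_ (𝟙_ C)).inv ≫ (𝟙_ C ◁ (H.one ≫ Δ[H.X]) ≫ (H.one ≫ Δ[H.X]) ▷ (H.X ⊗ H.X)) ⊗≫
    (H.X ◁ ((β_ H.X H.X).inv ≫ H.mul)) ▷ H.X ⊗≫ 𝟙 _ := by monoidal
    _ = _ := by rw [whisker_exchange]; monoidal

theorem coactOne_whiskerLeft {Y Z : C} (f : H.X ⊗ H.X ⟶ Y) (g : H.X ⟶ Z) :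
    H.coactOne f ≫ Y ◁ g =
      (ρ_ H.X).inv ≫ H.X ◁ (H.one ≫ Δ[H.X] ≫ H.X ◁ g) ⊗≫ f ▷ Z := by
  calc _ = (ρ_ H.X).inv ≫ H.X ◁ (H.one ≫ Δ[H.X]) ⊗≫ (f ▷ H.X ≫ Y ◁ g) := by
        rw [coactOne]; monoidal
    _ = _ := by rw [← whisker_exchange]; monoidal

theorem coactOne_comul {Y : C} (f : H.X ⊗ H.X ⟶ Y) :
    H.coactOne f ≫ Y ◁ Δ[H.X] = H.coactOne f ≫ Y ◁ H.coactOne H.mul := by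
  simp only [coactOne_whiskerLeft, one_comul_coactOne_mul]

theorem coactOne_comul_op {Y : C} (f : H.X ⊗ H.X ⟶ Y) :
    H.coactOne f ≫ Y ◁ Δ[H.X] =
      H.coactOne f ≫ Y ◁ H.coactOne ((β_ H.X H.X).inv ≫ H.mul) := by
  simp only [coactOne_whiskerLeft, one_comul_coactOne_mul_op]

/-- The counit applied to the middle leg of the braided form of (a3): the second leg of `δ(1)` is
fixed by `Π`. -/
theorem coactOne_target {Y : C} (f : H.X ⊗ H.X ⟶ Y) :
    H.coactOne f ≫ Y ◁ H.target = H.coactOne f := by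
  rw [target_eq_coactOne, ← Category.assoc (β_ H.X H.X).inv, coactOne_comp]
  simp only [whiskerLeft_comp, Category.assoc]
  rw [← reassoc_of% H.coactOne_comul_op f]
  simp only [← whiskerLeft_comp]
  simp

theorem coactOne_barSource {Y : C} (f : H.X ⊗ H.X ⟶ Y) :
    H.coactOne f ≫ Y ◁ H.barSource = H.coactOne f := by
  rw [barSource, coactOne_comp]
  simp only [whiskerLeft_comp, Category.assoc]
  rw [← reassoc_of% H.coactOne_comul f]
  simp only [← whiskerLeft_comp]
  simp

theorem target_target : H.target ≫ H.target = H.target := by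
  have h := H.coactOne_target ((β_ H.X H.X).inv ≫ H.mul ≫ ε[H.X]) =≫ (λ_ H.X).hom
  rwa [Category.assoc, leftUnitor_naturality, ← reassoc_of% H.target_eq_coactOne,
    ← target_eq_coactOne] at h

theorem target_barSource : H.target ≫ H.barSource = H.target := by
  have h := H.coactOne_barSource ((β_ H.X H.X).inv ≫ H.mul ≫ ε[H.X]) =≫ (λ_ H.X).hom
  rwa [Category.assoc, leftUnitor_naturality, ← reassoc_of% H.target_eq_coactOne,
    ← target_eq_coactOne] at h

theorem barSource_target : H.barSource ≫ H.target = H.barSource := by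
  have h := H.coactOne_target (H.mul ≫ ε[H.X]) =≫ (λ_ H.X).hom
  rwa [Category.assoc, leftUnitor_naturality, ← Category.assoc] at h

/-- Values of `Π` are second legs of `δ(1)` whose first leg has been evaluated, so (a3) computes
their coproduct. -/
theorem target_comul : H.target ≫ Δ[H.X] = H.target ≫ H.coactOne H.mul := by
  have h := H.coactOne_comul ((β_ H.X H.X).inv ≫ H.mul ≫ ε[H.X]) =≫ (λ_ _).hom
  rwa [Category.assoc, Category.assoc, leftUnitor_naturality, leftUnitor_naturality,
    ← reassoc_of% H.target_eq_coactOne, ← reassoc_of% H.target_eq_coactOne] at h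

theorem target_comul_target :
    H.target ≫ Δ[H.X] ≫ H.X ◁ H.target = H.target ≫ Δ[H.X] := by
  rw [reassoc_of% H.target_comul, coactOne_target, target_comul]

theorem one_comul_target : H.one ≫ Δ[H.X] ≫ H.X ◁ H.target = H.one ≫ Δ[H.X] := by
  rw [target_eq_coactOne, ← Category.assoc (β_ H.X H.X).inv, coactOne_comp]
  simp only [whiskerLeft_comp, Category.assoc]
  rw [← reassoc_of% H.one_comul_coactOne_mul_op]
  simp only [← whiskerLeft_comp]
  simp

theorem one_target : H.one ≫ H.target = H.one := by
  have h := H.one_comul_target =≫ (ε[H.X] ▷ H.X)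
  simp only [Category.assoc, whisker_exchange, counit_comul, counit_comul_assoc] at h
  simpa using h =≫ (λ_ _).hom

/-! ### Products whose left factor lies in the image of `Π`. -/

theorem comul_eq_one_comul_mul : Δ[H.X] = (λ_ H.X).inv ≫ (H.one ≫ Δ[H.X]) ▷ H.X ⊗≫
    H.X ◁ (H.X ◁ Δ[H.X] ⊗≫ (β_ H.X H.X).hom ▷ H.X) ⊗≫ (H.mul ▷ (H.X ⊗ H.X)) ⊗≫ H.X ◁ H.mul := by
  calc Δ[H.X] = (λ_ H.X).inv ≫ (H.one ▷ H.X ≫ H.mul) ≫ Δ[H.X] := by simp [H.one_mul]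
    _ = (λ_ H.X).inv ≫ H.one ▷ H.X ≫ (Δ[H.X] ⊗ₘ Δ[H.X]) ≫ tensorμ _ _ _ _ ≫
        (H.mul ⊗ₘ H.mul) := by rw [Category.assoc, H.mul_comul]
    _ = _ := by
      simp only [tensorμ, MonoidalCategory.tensorHom_def]
      monoidal

/-- `x ⊗ y ↦ ε (x y₁) y₂`. -/
def counitMulFst : H.X ⊗ H.X ⟶ H.X :=
  H.X ◁ Δ[H.X] ⊗≫ (H.mul ≫ ε[H.X]) ▷ H.X ⊗≫ 𝟙 H.X

theorem counit_mul_mul_eq_counitMulFst : H.X ◁ H.mul ≫ H.mul ≫ ε[H.X] =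
    (α_ H.X H.X H.X).inv ≫ H.counitMulFst ▷ H.X ≫ H.mul ≫ ε[H.X] := by
  rw [← cancel_epi (α_ H.X H.X H.X).hom, ← H.counit_mul_assoc, H.counit_mul_comul,
    counitMulFst, MonoidalCategory.tensorHom_def]
  monoidal

theorem counitMulFst_comul : H.counitMulFst ≫ Δ[H.X] =
    H.X ◁ Δ[H.X] ⊗≫ H.counitMulFst ▷ H.X := by
  calc H.counitMulFst ≫ Δ[H.X] =
      H.X ◁ Δ[H.X] ⊗≫ ((H.mul ≫ ε[H.X]) ▷ H.X ≫ 𝟙_ C ◁ Δ[H.X]) ⊗≫ 𝟙 (H.X ⊗ H.X) := by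
        rw [counitMulFst]; monoidal
    _ = H.X ◁ (Δ[H.X] ≫ H.X ◁ Δ[H.X]) ⊗≫ (H.mul ≫ ε[H.X]) ▷ (H.X ⊗ H.X) ⊗≫
        𝟙 (H.X ⊗ H.X) := by rw [← whisker_exchange]; monoidal
    _ = _ := by rw [comul_assoc, counitMulFst]; monoidal

theorem barSource_eq_counitMulFst :
    H.barSource = (ρ_ H.X).inv ≫ H.X ◁ H.one ≫ H.counitMulFst := by
  rw [barSource, coactOne, counitMulFst]; monoidal

/-- `(ε (x 1₁) 1₂) y = ε (x y₁) y₂`. -/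
theorem barSource_mul : H.barSource ▷ H.X ≫ H.mul = H.counitMulFst := by
  symm
  -- Expanding `δ(y) = δ(1 y)` by (a1) gives `ε(x (1₁ y₁)) 1₂ y₂`. By (a2) and coassociativity this
  -- is `ε(w₁ y₁) w₂ y₂` with `w = ε(x 1₁) 1₂`, which is `w y` by (a1).
  calc H.counitMulFst = H.X ◁ ((λ_ H.X).inv ≫ (H.one ≫ Δ[H.X]) ▷ H.X ⊗≫
        H.X ◁ (H.X ◁ Δ[H.X] ⊗≫ (β_ H.X H.X).hom ▷ H.X)) ⊗≫ H.X ◁ H.mul ▷ (H.X ⊗ H.X) ⊗≫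
        ((H.X ⊗ H.X) ◁ H.mul ≫ (H.mul ≫ ε[H.X]) ▷ H.X) ⊗≫ 𝟙 H.X := by
        rw [counitMulFst]; nth_rw 1 [comul_eq_one_comul_mul]; monoidal
    _ = H.X ◁ ((λ_ H.X).inv ≫ (H.one ≫ Δ[H.X]) ▷ H.X ⊗≫
        H.X ◁ (H.X ◁ Δ[H.X] ⊗≫ (β_ H.X H.X).hom ▷ H.X)) ⊗≫
        (H.X ◁ H.mul ≫ H.mul ≫ ε[H.X]) ▷ (H.X ⊗ H.X) ⊗≫ H.mul := by
        rw [whisker_exchange]; monoidal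
    _ = H.X ◁ ((λ_ H.X).inv ≫ (H.one ≫ Δ[H.X]) ▷ H.X) ⊗≫
        ((H.X ⊗ H.X) ◁ (H.X ◁ Δ[H.X] ⊗≫ (β_ H.X H.X).hom ▷ H.X) ≫
        H.counitMulFst ▷ ((H.X ⊗ H.X) ⊗ H.X)) ⊗≫ (H.mul ≫ ε[H.X]) ▷ (H.X ⊗ H.X) ⊗≫ H.mul := by
        rw [counit_mul_mul_eq_counitMulFst]; monoidal
    _ = ((ρ_ H.X).inv ≫ H.X ◁ H.one ≫ (H.X ◁ Δ[H.X] ⊗≫ H.counitMulFst ▷ H.X)) ▷ H.X ⊗≫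
        (H.X ◁ (H.X ◁ Δ[H.X] ⊗≫ (β_ H.X H.X).hom ▷ H.X)) ⊗≫
          (H.mul ≫ ε[H.X]) ▷ (H.X ⊗ H.X) ⊗≫ H.mul := by
        rw [whisker_exchange]; monoidal
    _ = H.barSource ▷ H.X ≫ Δ[H.X] ▷ H.X ⊗≫
        (H.X ◁ (H.X ◁ Δ[H.X] ⊗≫ (β_ H.X H.X).hom ▷ H.X)) ⊗≫ H.mul ▷ (H.X ⊗ H.X) ⊗≫
          (ε[H.X] ▷ (H.X ⊗ H.X) ≫ 𝟙_ C ◁ H.mul) ⊗≫ 𝟙 H.X := by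
        rw [← counitMulFst_comul, barSource_eq_counitMulFst]; monoidal
    _ = H.barSource ▷ H.X ≫ ((Δ[H.X] ⊗ₘ Δ[H.X]) ≫ tensorμ _ _ _ _ ≫ (H.mul ⊗ₘ H.mul)) ≫
          ε[H.X] ▷ H.X ≫ (λ_ H.X).hom := by
        rw [← whisker_exchange]
        simp only [tensorμ, MonoidalCategory.tensorHom_def]
        monoidal
    _ = _ := by rw [← H.mul_comul]; simp

/-- `x ⊗ y ↦ y₁ ⊗ x ⊗ y₂`. -/
def shuffle : H.X ⊗ H.X ⟶ H.X ⊗ H.X ⊗ H.X :=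
  H.X ◁ Δ[H.X] ⊗≫ (β_ H.X H.X).hom ▷ H.X ⊗≫ 𝟙 (H.X ⊗ H.X ⊗ H.X)

theorem mul_comul_eq_shuffle : H.mul ≫ Δ[H.X] =
    Δ[H.X] ▷ H.X ⊗≫ H.X ◁ H.shuffle ⊗≫ H.mul ▷ (H.X ⊗ H.X) ⊗≫ H.X ◁ H.mul := by
  rw [H.mul_comul, shuffle]
  simp only [tensorμ, MonoidalCategory.tensorHom_def]
  monoidal

/-- The counit on the first leg of (a1): `x y = ε(x₁ y₁) x₂ y₂`. It moves one copy of a product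
under `ε`, where (a2) allows reassociation. -/
theorem mul_eq_counit_fst : H.mul =
    Δ[H.X] ▷ H.X ⊗≫ H.X ◁ H.shuffle ⊗≫ (H.mul ≫ ε[H.X]) ▷ (H.X ⊗ H.X) ⊗≫ H.mul := by
  calc H.mul = (H.mul ≫ Δ[H.X]) ≫ ε[H.X] ▷ H.X ≫ (λ_ H.X).hom := by simp
    _ = Δ[H.X] ▷ H.X ⊗≫ H.X ◁ H.shuffle ⊗≫ H.mul ▷ (H.X ⊗ H.X) ⊗≫
        (H.X ◁ H.mul ≫ ε[H.X] ▷ H.X) ⊗≫ 𝟙 H.X := by rw [mul_comul_eq_shuffle]; monoidal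
    _ = _ := by rw [whisker_exchange]; monoidal

theorem mul_eq_counit_snd : H.mul =
    Δ[H.X] ▷ H.X ⊗≫ H.X ◁ H.shuffle ⊗≫ H.mul ▷ (H.X ⊗ H.X) ⊗≫ H.X ◁ (H.mul ≫ ε[H.X]) ⊗≫
      𝟙 H.X := by
  calc H.mul = (H.mul ≫ Δ[H.X]) ≫ H.X ◁ ε[H.X] ≫ (ρ_ H.X).hom := by simp
    _ = _ := by rw [mul_comul_eq_shuffle]; monoidal

theorem target_mul : H.target ▷ H.X ≫ H.mul = H.target ▷ H.X ≫ H.counitMulFst := by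
  rw [← barSource_mul, ← comp_whiskerRight_assoc, target_barSource]

theorem target_mul_comul : (H.target ▷ H.X ≫ H.mul) ≫ Δ[H.X] =
    H.X ◁ Δ[H.X] ⊗≫ (H.target ▷ H.X ≫ H.mul) ▷ H.X := by
  calc _ = (H.target ▷ H.X ≫ H.X ◁ Δ[H.X]) ⊗≫ H.counitMulFst ▷ H.X := by
        rw [target_mul, Category.assoc, counitMulFst_comul]; monoidal
    _ = _ := by rw [target_mul, ← whisker_exchange]; monoidal

/-- `(z x) y = z (x y)` for `z` in the image of the target morphism. -/
theorem target_mul_mul : (H.target ▷ H.X ≫ H.mul) ▷ H.X ≫ H.mul =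
    (α_ H.X H.X H.X).hom ≫ H.X ◁ H.mul ≫ H.target ▷ H.X ≫ H.mul := by
  -- Both sides are brought to the form `ε((z x₁) y₁) x₂ y₂`.
  have h1 : (H.target ▷ H.X ≫ H.mul) ▷ H.X ≫ H.mul =
      (α_ H.X H.X H.X).hom ≫ H.X ◁ (Δ[H.X] ▷ H.X) ⊗≫ (H.X ⊗ H.X) ◁ H.shuffle ⊗≫
        (H.target ▷ H.X ≫ H.mul) ▷ (H.X ⊗ H.X ⊗ H.X) ⊗≫ (H.mul ≫ ε[H.X]) ▷ (H.X ⊗ H.X) ⊗≫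
        H.mul := by
    calc _ = ((H.target ▷ H.X ≫ H.mul) ≫ Δ[H.X]) ▷ H.X ⊗≫ H.X ◁ H.shuffle ⊗≫
          (H.mul ≫ ε[H.X]) ▷ (H.X ⊗ H.X) ⊗≫ H.mul := by
          nth_rw 2 [mul_eq_counit_fst]; monoidal
      _ = (H.X ◁ Δ[H.X]) ▷ H.X ⊗≫ ((H.target ▷ H.X ≫ H.mul) ▷ (H.X ⊗ H.X) ≫
          H.X ◁ H.shuffle) ⊗≫ (H.mul ≫ ε[H.X]) ▷ (H.X ⊗ H.X) ⊗≫ H.mul := by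
          rw [target_mul_comul]; monoidal
      _ = _ := by rw [← whisker_exchange]; monoidal
  rw [h1]
  symm
  calc (α_ H.X H.X H.X).hom ≫ H.X ◁ H.mul ≫ H.target ▷ H.X ≫ H.mul =
      (α_ H.X H.X H.X).hom ≫ (H.X ◁ (H.mul ≫ Δ[H.X]) ≫ H.target ▷ (H.X ⊗ H.X)) ⊗≫
        (H.mul ≫ ε[H.X]) ▷ H.X ⊗≫ 𝟙 H.X := by
        rw [target_mul, whiskerLeft_comp, Category.assoc, whisker_exchange, counitMulFst]
        monoidal
    _ = (α_ H.X H.X H.X).hom ≫ H.target ▷ ((H.X ⊗ H.X)) ≫ H.X ◁ (Δ[H.X] ▷ H.X) ⊗≫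
        (H.X ⊗ H.X) ◁ H.shuffle ⊗≫ (H.X ◁ H.mul) ▷ (H.X ⊗ H.X) ⊗≫
        ((H.X ⊗ H.X) ◁ H.mul ≫ (H.mul ≫ ε[H.X]) ▷ H.X) ⊗≫ 𝟙 H.X := by
        rw [whisker_exchange, mul_comul_eq_shuffle]; monoidal
    _ = (α_ H.X H.X H.X).hom ≫ H.target ▷ ((H.X ⊗ H.X)) ≫ H.X ◁ (Δ[H.X] ▷ H.X) ⊗≫
        (H.X ⊗ H.X) ◁ H.shuffle ⊗≫ ((α_ H.X H.X H.X).hom ≫ H.X ◁ H.mul ≫ H.mul ≫ ε[H.X]) ▷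
          (H.X ⊗ H.X) ⊗≫ H.mul := by
        rw [whisker_exchange]; monoidal
    -- The only reassociation takes place under `ε`.
    _ = (α_ H.X H.X H.X).hom ≫ (H.target ▷ ((H.X ⊗ H.X)) ≫ H.X ◁ (Δ[H.X] ▷ H.X ⊗≫
        H.X ◁ H.shuffle)) ⊗≫ (H.mul ▷ H.X ≫ H.mul ≫ ε[H.X]) ▷ (H.X ⊗ H.X) ⊗≫ H.mul := by
        rw [← counit_mul_assoc]; monoidal
    _ = _ := by rw [← whisker_exchange]; monoidal

/-- For `z` in the image of `Π`, `ε((x z) 1₁) 1₂ = ε(x (z 1₁)) 1₂ = ε(x z₁) z₂`, by (a2) and then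
`target_comul`. -/
theorem mul_target_barSource : H.X ◁ H.target ≫ H.mul ≫ H.barSource =
    H.X ◁ H.target ≫ H.barSource ▷ H.X ≫ H.mul := by
  calc H.X ◁ H.target ≫ H.mul ≫ H.barSource =
      H.X ◁ H.target ⊗≫ (H.mul ▷ 𝟙_ C ≫ H.X ◁ (H.one ≫ Δ[H.X])) ⊗≫
        (H.mul ≫ ε[H.X]) ▷ H.X ⊗≫ 𝟙 H.X := by rw [barSource, coactOne]; monoidal
    _ = H.X ◁ H.target ⊗≫ H.X ◁ (H.X ◁ (H.one ≫ Δ[H.X])) ⊗≫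
        (H.mul ▷ H.X ≫ H.mul ≫ ε[H.X]) ▷ H.X ⊗≫ 𝟙 H.X := by rw [← whisker_exchange]; monoidal
    _ = H.X ◁ (H.target ≫ H.coactOne H.mul) ⊗≫ (H.mul ≫ ε[H.X]) ▷ H.X ⊗≫ 𝟙 H.X := by
        rw [H.counit_mul_assoc, coactOne]; monoidal
    _ = _ := by rw [barSource_mul, ← target_comul, counitMulFst]; monoidal

/-- The image of the target morphism is closed under the product. -/
theorem target_mul_target : (H.target ⊗ₘ H.target) ≫ H.mul ≫ H.target =
    (H.target ⊗ₘ H.target) ≫ H.mul := by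
  have h : (H.target ⊗ₘ H.target) ≫ H.mul ≫ H.barSource =
      (H.target ⊗ₘ H.target) ≫ H.mul := by
    rw [MonoidalCategory.tensorHom_def, Category.assoc, mul_target_barSource,
      whisker_exchange_assoc, ← comp_whiskerRight_assoc, target_barSource, Category.assoc]
  rw [← reassoc_of% h, barSource_target, h]

/-! ### The source morphism and the coproduct of the antipode. -/

/-- `x ⊗ y ↦ y₁ ε (x y₂)`. -/
def counitMulSnd : H.X ⊗ H.X ⟶ H.X :=
  H.X ◁ Δ[H.X] ⊗≫ (β_ H.X H.X).hom ▷ H.X ⊗≫ H.X ◁ (H.mul ≫ ε[H.X]) ⊗≫ 𝟙 H.X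

theorem source_eq_counitMulSnd :
    H.source = (ρ_ H.X).inv ≫ H.X ◁ H.one ≫ H.counitMulSnd := by
  have h : H.source = _ := H.source_eq
  rw [h, counitMulSnd]
  monoidal

theorem counitMulSnd_eq_braiding_inv : H.counitMulSnd =
    H.X ◁ (Δ[H.X] ≫ (β_ H.X H.X).inv) ⊗≫ (H.mul ≫ ε[H.X]) ▷ H.X ⊗≫ 𝟙 H.X := by
  have h := braiding_naturality_left (H.mul ≫ ε[H.X]) H.X
  rw [braiding_tensorUnit_left, braiding_tensor_left_comp] at h
  symm
  calc _ = H.X ◁ (Δ[H.X] ≫ (β_ H.X H.X).inv) ⊗≫ ((H.mul ≫ ε[H.X]) ▷ H.X ≫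
        (λ_ H.X).hom ≫ (ρ_ H.X).inv) ⊗≫ 𝟙 H.X := by monoidal
    _ = H.X ◁ (Δ[H.X] ≫ (β_ H.X H.X).inv ≫ (β_ H.X H.X).hom) ⊗≫
        (β_ H.X H.X).hom ▷ H.X ⊗≫ H.X ◁ (H.mul ≫ ε[H.X]) ⊗≫ 𝟙 H.X := by
        rw [h]; monoidal
    _ = _ := by rw [Iso.inv_hom_id, counitMulSnd]; monoidal

theorem counit_mul_mul_eq_counitMulSnd : H.X ◁ H.mul ≫ H.mul ≫ ε[H.X] =
    (α_ H.X H.X H.X).inv ≫ H.counitMulSnd ▷ H.X ≫ H.mul ≫ ε[H.X] := by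
  rw [← cancel_epi (α_ H.X H.X H.X).hom, ← H.counit_mul_assoc, H.counit_mul_comul_braid,
    counitMulSnd_eq_braiding_inv, MonoidalCategory.tensorHom_def]
  monoidal

theorem counitMulSnd_comul : H.counitMulSnd ≫ Δ[H.X] = H.shuffle ≫ H.X ◁ H.counitMulSnd := by
  calc H.counitMulSnd ≫ Δ[H.X] = H.X ◁ Δ[H.X] ⊗≫ (β_ H.X H.X).hom ▷ H.X ⊗≫
      (H.X ◁ (H.mul ≫ ε[H.X]) ≫ Δ[H.X] ▷ 𝟙_ C) ⊗≫ 𝟙 (H.X ⊗ H.X) := by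
        rw [counitMulSnd]; monoidal
    _ = H.X ◁ Δ[H.X] ⊗≫ ((β_ H.X H.X).hom ≫ Δ[H.X] ▷ H.X) ▷ H.X ⊗≫
      ((H.X ⊗ H.X) ◁ (H.mul ≫ ε[H.X])) ⊗≫ 𝟙 (H.X ⊗ H.X) := by
        rw [whisker_exchange]; monoidal
    _ = H.X ◁ (Δ[H.X] ≫ Δ[H.X] ▷ H.X ≫ (α_ _ _ _).hom) ⊗≫ (β_ H.X H.X).hom ▷ (H.X ⊗ H.X) ⊗≫
      H.X ◁ ((β_ H.X H.X).hom ▷ H.X) ⊗≫ ((H.X ⊗ H.X) ◁ (H.mul ≫ ε[H.X])) ⊗≫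
      𝟙 (H.X ⊗ H.X) := by
        rw [← braiding_naturality_right, braiding_tensor_right_comp]; monoidal
    _ = H.X ◁ Δ[H.X] ⊗≫ ((H.X ⊗ H.X) ◁ Δ[H.X] ≫ (β_ H.X H.X).hom ▷ (H.X ⊗ H.X)) ⊗≫
      H.X ◁ ((β_ H.X H.X).hom ▷ H.X) ⊗≫ ((H.X ⊗ H.X) ◁ (H.mul ≫ ε[H.X])) ⊗≫
      𝟙 (H.X ⊗ H.X) := by
        rw [← comul_assoc]; monoidal
    _ = _ := by rw [whisker_exchange, shuffle, counitMulSnd]; monoidal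

theorem counitMulSnd_shuffle : H.X ◁ H.shuffle ⊗≫ (β_ H.X H.X).hom ▷ (H.X ⊗ H.X) ⊗≫
      H.X ◁ (H.counitMulSnd ▷ H.X) =
    (α_ H.X H.X H.X).inv ≫ H.counitMulSnd ▷ H.X ≫ H.shuffle := by
  symm
  calc (α_ H.X H.X H.X).inv ≫ H.counitMulSnd ▷ H.X ≫ H.shuffle =
      (α_ H.X H.X H.X).inv ≫ (H.counitMulSnd ▷ H.X ≫ H.X ◁ Δ[H.X]) ⊗≫
        (β_ H.X H.X).hom ▷ H.X ⊗≫ 𝟙 _ := by rw [shuffle]; monoidal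
    _ = (α_ H.X H.X H.X).inv ≫ (H.X ⊗ H.X) ◁ Δ[H.X] ⊗≫
        (H.counitMulSnd ▷ H.X ≫ (β_ H.X H.X).hom) ▷ H.X ⊗≫ 𝟙 _ := by
        rw [← whisker_exchange]; monoidal
    _ = _ := by
        rw [braiding_naturality_left, braiding_tensor_left_comp, shuffle]; monoidal

/-- `Πᴿ (x) y = y₁ ε (x y₂)`. -/
theorem source_mul : H.source ▷ H.X ≫ H.mul = H.counitMulSnd := by
  symm
  calc H.counitMulSnd = H.X ◁ ((λ_ H.X).inv ≫ (H.one ≫ Δ[H.X]) ▷ H.X ⊗≫ H.X ◁ H.shuffle) ⊗≫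
        H.X ◁ H.mul ▷ (H.X ⊗ H.X) ⊗≫ ((H.X ⊗ H.X) ◁ H.mul ≫ (β_ H.X H.X).hom ▷ H.X) ⊗≫
        H.X ◁ (H.mul ≫ ε[H.X]) ⊗≫ 𝟙 H.X := by
        rw [counitMulSnd, shuffle]; nth_rw 1 [comul_eq_one_comul_mul]; monoidal
    _ = H.X ◁ ((λ_ H.X).inv ≫ (H.one ≫ Δ[H.X]) ▷ H.X ⊗≫ H.X ◁ H.shuffle) ⊗≫
        (H.X ◁ H.mul ≫ (β_ H.X H.X).hom) ▷ (H.X ⊗ H.X) ⊗≫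
        H.X ◁ (H.X ◁ H.mul ≫ H.mul ≫ ε[H.X]) ⊗≫ 𝟙 H.X := by
        rw [whisker_exchange]; monoidal
    _ = H.X ◁ ((λ_ H.X).inv ≫ (H.one ≫ Δ[H.X]) ▷ H.X) ⊗≫
        ((H.X ⊗ H.X) ◁ H.shuffle ≫ (β_ H.X H.X).hom ▷ (H.X ⊗ H.X ⊗ H.X)) ⊗≫
        H.X ◁ ((β_ H.X H.X).hom ▷ (H.X ⊗ H.X)) ⊗≫
        (H.mul ▷ ((H.X ⊗ H.X) ⊗ H.X) ≫ H.X ◁ (H.counitMulSnd ▷ H.X)) ⊗≫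
        H.X ◁ (H.mul ≫ ε[H.X]) ⊗≫ 𝟙 H.X := by
        rw [braiding_naturality_right, braiding_tensor_right_comp,
          counit_mul_mul_eq_counitMulSnd]
        monoidal
    _ = H.X ◁ ((λ_ H.X).inv ≫ (H.one ≫ Δ[H.X]) ▷ H.X) ⊗≫
        (β_ H.X H.X).hom ▷ (H.X ⊗ H.X) ⊗≫ H.X ◁ (H.X ◁ H.shuffle ⊗≫
          (β_ H.X H.X).hom ▷ (H.X ⊗ H.X) ⊗≫ H.X ◁ (H.counitMulSnd ▷ H.X)) ⊗≫
        H.mul ▷ (H.X ⊗ H.X) ⊗≫ H.X ◁ (H.mul ≫ ε[H.X]) ⊗≫ 𝟙 H.X := by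
        rw [whisker_exchange, ← whisker_exchange H.mul]; monoidal
    _ = ((ρ_ H.X).inv ≫ H.X ◁ H.one ≫ H.shuffle ≫ H.X ◁ H.counitMulSnd) ▷ H.X ⊗≫
        H.X ◁ H.shuffle ⊗≫
        H.mul ▷ (H.X ⊗ H.X) ⊗≫ H.X ◁ (H.mul ≫ ε[H.X]) ⊗≫ 𝟙 H.X := by
        rw [counitMulSnd_shuffle]; nth_rw 2 [shuffle]; monoidal
    _ = H.source ▷ H.X ≫ (Δ[H.X] ▷ H.X ⊗≫ H.X ◁ H.shuffle ⊗≫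
        H.mul ▷ (H.X ⊗ H.X) ⊗≫ H.X ◁ (H.mul ≫ ε[H.X]) ⊗≫ 𝟙 H.X) := by
        rw [← counitMulSnd_comul, source_eq_counitMulSnd]; monoidal
    _ = _ := by rw [← mul_eq_counit_snd]

/-- By coassociativity the left side is `y₁ ⊗ ε(x₁ y₂) x₂ y₃`, and `mul_eq_counit_fst` collapses its
second leg to `x y₂`. -/
theorem shuffle_counitMulSnd_mul :
    Δ[H.X] ▷ H.X ⊗≫ H.X ◁ H.shuffle ⊗≫ H.counitMulSnd ▷ (H.X ⊗ H.X) ⊗≫ H.X ◁ H.mul =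
      H.shuffle ≫ H.X ◁ H.mul := by
  symm
  calc H.shuffle ≫ H.X ◁ H.mul = H.X ◁ Δ[H.X] ⊗≫ ((β_ H.X H.X).hom ≫ H.X ◁ Δ[H.X]) ▷ H.X ⊗≫
        H.X ◁ H.X ◁ H.shuffle ⊗≫ H.X ◁ (H.mul ≫ ε[H.X]) ▷ (H.X ⊗ H.X) ⊗≫ H.X ◁ H.mul := by
        nth_rw 1 [shuffle, mul_eq_counit_fst]; monoidal
    _ = H.X ◁ Δ[H.X] ⊗≫ (Δ[H.X] ▷ H.X ⊗≫ H.X ◁ (β_ H.X H.X).hom ⊗≫ (β_ H.X H.X).hom ▷ H.X) ▷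
        H.X ⊗≫ H.X ◁ H.X ◁ H.shuffle ⊗≫ H.X ◁ (H.mul ≫ ε[H.X]) ▷ (H.X ⊗ H.X) ⊗≫
        H.X ◁ H.mul := by
        rw [← braiding_naturality_left, braiding_tensor_left_comp]; monoidal
    _ = (H.X ◁ Δ[H.X] ≫ Δ[H.X] ▷ (H.X ⊗ H.X)) ⊗≫ H.X ◁ (β_ H.X H.X).hom ▷ H.X ⊗≫
        ((β_ H.X H.X).hom ▷ (H.X ⊗ H.X) ≫ (H.X ⊗ H.X) ◁ H.shuffle) ⊗≫
        H.X ◁ (H.mul ≫ ε[H.X]) ▷ (H.X ⊗ H.X) ⊗≫ H.X ◁ H.mul := by monoidal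
    _ = Δ[H.X] ▷ H.X ⊗≫ H.X ◁ (H.X ◁ Δ[H.X]) ⊗≫
        H.X ◁ ((β_ H.X H.X).hom ▷ H.X ≫ (H.X ⊗ H.X) ◁ Δ[H.X]) ⊗≫
        ((H.X ⊗ H.X) ◁ (β_ H.X H.X).hom ▷ H.X ≫
        (β_ H.X H.X).hom ▷ ((H.X ⊗ H.X) ⊗ H.X)) ⊗≫
        H.X ◁ (H.mul ≫ ε[H.X]) ▷ (H.X ⊗ H.X) ⊗≫ H.X ◁ H.mul := by
        rw [whisker_exchange, ← whisker_exchange _ H.shuffle, shuffle]; monoidal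
    _ = Δ[H.X] ▷ H.X ⊗≫ H.X ◁ (H.X ◁ (Δ[H.X] ≫ H.X ◁ Δ[H.X])) ⊗≫
        H.X ◁ ((β_ H.X H.X).hom ▷ (H.X ⊗ H.X)) ⊗≫
        ((H.X ⊗ H.X) ◁ (β_ H.X H.X).hom ▷ H.X ≫
        (β_ H.X H.X).hom ▷ ((H.X ⊗ H.X) ⊗ H.X)) ⊗≫
        H.X ◁ (H.mul ≫ ε[H.X]) ▷ (H.X ⊗ H.X) ⊗≫ H.X ◁ H.mul := by
        rw [← whisker_exchange]; monoidal
    _ = Δ[H.X] ▷ H.X ⊗≫ H.X ◁ (H.X ◁ Δ[H.X]) ⊗≫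
        H.X ◁ (H.X ◁ Δ[H.X] ≫ (β_ H.X (H.X ⊗ H.X)).hom) ▷ H.X ⊗≫
        (β_ H.X H.X).hom ▷ (H.X ⊗ H.X ⊗ H.X) ⊗≫
        H.X ◁ (H.mul ≫ ε[H.X]) ▷ (H.X ⊗ H.X) ⊗≫ H.X ◁ H.mul := by
        rw [comul_assoc, braiding_tensor_right_comp]; monoidal
    _ = _ := by
        rw [braiding_naturality_right, counitMulSnd, shuffle]; monoidal

/-- `x ↦ λ (x₂)₁ ⊗ x₁ λ (x₂)₂`. -/
def antipodeComul : H.X ⟶ H.X ⊗ H.X :=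
  Δ[H.X] ≫ H.X ◁ H.antipode ≫ H.shuffle ≫ H.X ◁ H.mul

/-- Replaces any anticomultiplicativity of the antipode. Expanding `δ(x₂ λ(x₃))` on the right
produces a factor `λ(x₁)(x₂ y)`, which (a4-4) turns into `Πᴿ(x₁) y`; `source_mul` and
`shuffle_counitMulSnd_mul` then absorb it. -/
theorem antipodeComul_eq : H.antipodeComul =
    Δ[H.X] ≫ H.X ◁ (H.target ≫ Δ[H.X]) ⊗≫ (H.antipode ▷ H.X ≫ H.mul) ▷ H.X := by
  have ht : H.target = Δ[H.X] ≫ H.X ◁ H.antipode ≫ H.mul := by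
    simp [target, convolution]
  have hs : (Δ[H.X] ▷ H.X) ⊗≫ H.X ◁ H.mul ⊗≫ H.antipode ▷ H.X ≫ H.mul = H.counitMulSnd := by
    have h := H.antipode_mul
    rw [MonoidalCategory.tensorHom_def'] at h
    rw [← source_mul]
    refine Eq.trans ?_ h
    monoidal
  symm
  calc Δ[H.X] ≫ H.X ◁ (H.target ≫ Δ[H.X]) ⊗≫ (H.antipode ▷ H.X ≫ H.mul) ▷ H.X =
      Δ[H.X] ≫ H.X ◁ Δ[H.X] ≫ H.X ◁ (H.X ◁ H.antipode ≫ Δ[H.X] ▷ H.X) ⊗≫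
        (H.X ⊗ H.X) ◁ H.shuffle ⊗≫ (H.X ◁ H.mul) ▷ (H.X ⊗ H.X) ⊗≫
        ((H.X ⊗ H.X) ◁ H.mul ≫ (H.antipode ▷ H.X ≫ H.mul) ▷ H.X) := by
        rw [ht, Category.assoc, Category.assoc, mul_comul_eq_shuffle]; monoidal
    _ = (Δ[H.X] ≫ H.X ◁ Δ[H.X]) ⊗≫ (H.X ◁ Δ[H.X]) ▷ H.X ⊗≫
        (H.X ⊗ H.X) ◁ (H.X ◁ H.antipode ≫ H.shuffle) ⊗≫
        (H.X ◁ H.mul ⊗≫ H.antipode ▷ H.X ≫ H.mul) ▷ (H.X ⊗ H.X) ⊗≫ H.X ◁ H.mul := by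
        rw [whisker_exchange, whisker_exchange]; monoidal
    _ = Δ[H.X] ≫ (Δ[H.X] ≫ H.X ◁ Δ[H.X]) ▷ H.X ⊗≫
        (H.X ⊗ H.X) ◁ (H.X ◁ H.antipode ≫ H.shuffle) ⊗≫
        (H.X ◁ H.mul ⊗≫ H.antipode ▷ H.X ≫ H.mul) ▷ (H.X ⊗ H.X) ⊗≫ H.X ◁ H.mul := by
        nth_rw 1 [comul_assoc]; monoidal
    _ = Δ[H.X] ≫ Δ[H.X] ▷ H.X ⊗≫ (Δ[H.X] ▷ (H.X ⊗ H.X) ≫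
        (H.X ⊗ H.X) ◁ (H.X ◁ H.antipode ≫ H.shuffle)) ⊗≫
        (H.X ◁ H.mul ⊗≫ H.antipode ▷ H.X ≫ H.mul) ▷ (H.X ⊗ H.X) ⊗≫ H.X ◁ H.mul := by
        rw [comul_assoc]; monoidal
    _ = Δ[H.X] ≫ (Δ[H.X] ▷ H.X ≫ (H.X ⊗ H.X) ◁ H.antipode) ⊗≫ H.X ◁ H.shuffle ⊗≫
        (Δ[H.X] ▷ H.X ⊗≫ H.X ◁ H.mul ⊗≫ H.antipode ▷ H.X ≫ H.mul) ▷ (H.X ⊗ H.X) ⊗≫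
        H.X ◁ H.mul := by
        rw [← whisker_exchange]; monoidal
    _ = Δ[H.X] ≫ H.X ◁ H.antipode ≫ (Δ[H.X] ▷ H.X ⊗≫ H.X ◁ H.shuffle ⊗≫
        H.counitMulSnd ▷ (H.X ⊗ H.X) ⊗≫ H.X ◁ H.mul) := by
        rw [hs, ← whisker_exchange]; monoidal
    _ = _ := by rw [shuffle_counitMulSnd_mul, antipodeComul]

theorem antipodeComul_target : H.antipodeComul ≫ H.X ◁ H.target = H.antipodeComul := by
  rw [antipodeComul_eq]
  calc _ = Δ[H.X] ≫ H.X ◁ (H.target ≫ Δ[H.X]) ⊗≫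
        ((H.antipode ▷ H.X ≫ H.mul) ▷ H.X ≫ H.X ◁ H.target) := by monoidal
    _ = Δ[H.X] ≫ H.X ◁ (H.target ≫ Δ[H.X] ≫ H.X ◁ H.target) ⊗≫
        (H.antipode ▷ H.X ≫ H.mul) ▷ H.X := by rw [← whisker_exchange]; monoidal
    _ = _ := by rw [target_comul_target]

/-- `Π(x₁) x₂ = ε(1₁ x₁) 1₂ x₂`, which is `1 x` by `mul_eq_counit_fst`. -/
theorem comul_target_mul : Δ[H.X] ≫ H.target ▷ H.X ≫ H.mul = 𝟙 H.X := by
  have ht : H.target = _ := H.target_eq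
  calc Δ[H.X] ≫ H.target ▷ H.X ≫ H.mul =
      (λ_ H.X).inv ≫ (𝟙_ C ◁ Δ[H.X] ≫ (H.one ≫ Δ[H.X]) ▷ (H.X ⊗ H.X)) ⊗≫
        H.X ◁ (β_ H.X H.X).hom ▷ H.X ⊗≫ (H.mul ≫ ε[H.X]) ▷ (H.X ⊗ H.X) ⊗≫ H.mul := by
        rw [ht]; monoidal
    _ = (λ_ H.X).inv ≫ H.one ▷ H.X ≫ (Δ[H.X] ▷ H.X ⊗≫ H.X ◁ H.shuffle ⊗≫
        (H.mul ≫ ε[H.X]) ▷ (H.X ⊗ H.X) ⊗≫ H.mul) := by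
        rw [whisker_exchange, shuffle]; monoidal
    _ = 𝟙 H.X := by rw [← mul_eq_counit_fst, H.one_mul, Iso.inv_hom_id]

theorem target_shuffle : H.target ▷ H.X ≫ H.shuffle =
    H.shuffle ≫ H.X ◁ (H.target ▷ H.X) := by
  calc H.target ▷ H.X ≫ H.shuffle = (H.target ▷ H.X ≫ H.X ◁ Δ[H.X]) ⊗≫
        (β_ H.X H.X).hom ▷ H.X ⊗≫ 𝟙 (H.X ⊗ H.X ⊗ H.X) := by rw [shuffle]; monoidal
    _ = H.X ◁ Δ[H.X] ⊗≫ (H.target ▷ H.X ≫ (β_ H.X H.X).hom) ▷ H.X ⊗≫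
        𝟙 (H.X ⊗ H.X ⊗ H.X) := by rw [← whisker_exchange]; monoidal
    _ = _ := by rw [braiding_naturality_left, shuffle]; monoidal

theorem target_shuffle_mul : H.target ▷ H.X ≫ H.shuffle ≫ H.X ◁ H.mul =
    H.target ▷ H.X ≫ H.shuffle ≫ H.X ◁ H.counitMulFst := by
  simp only [reassoc_of% H.target_shuffle, ← whiskerLeft_comp, target_mul]

theorem shuffle_counitMulFst : H.shuffle ≫ H.X ◁ H.counitMulFst =
    H.X ◁ Δ[H.X] ⊗≫ (H.shuffle ≫ H.X ◁ (H.mul ≫ ε[H.X])) ▷ H.X ⊗≫ 𝟙 (H.X ⊗ H.X) := by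
  calc H.shuffle ≫ H.X ◁ H.counitMulFst = H.X ◁ Δ[H.X] ⊗≫
        ((β_ H.X H.X).hom ▷ H.X ≫ (H.X ⊗ H.X) ◁ Δ[H.X]) ⊗≫
        H.X ◁ ((H.mul ≫ ε[H.X]) ▷ H.X) ⊗≫ 𝟙 (H.X ⊗ H.X) := by
        rw [shuffle, counitMulFst]; monoidal
    _ = H.X ◁ (Δ[H.X] ≫ H.X ◁ Δ[H.X]) ⊗≫ (β_ H.X H.X).hom ▷ (H.X ⊗ H.X) ⊗≫
        H.X ◁ ((H.mul ≫ ε[H.X]) ▷ H.X) ⊗≫ 𝟙 (H.X ⊗ H.X) := by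
        rw [← whisker_exchange]; monoidal
    _ = _ := by rw [comul_assoc, shuffle]; monoidal

/-! ### The monoid `H_L`. -/

theorem splitting_mul_i (L : Splitting H.target) :
    ((L.i ⊗ₘ L.i) ≫ H.mul ≫ L.p) ≫ L.i = (L.i ⊗ₘ L.i) ≫ H.mul := by
  have h := (L.i ⊗ₘ L.i) ≫= H.target_mul_target
  simp only [tensorHom_comp_tensorHom_assoc, L.i_comp] at h
  simpa only [Category.assoc, L.p_i] using h

theorem splitting_mul_mul (L : Splitting H.target) :
    ((L.i ⊗ₘ L.i) ≫ H.mul) ▷ L.obj ≫ H.X ◁ L.i ≫ H.mul =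
      (α_ _ _ _).hom ≫ L.obj ◁ ((L.i ⊗ₘ L.i) ≫ H.mul) ≫ L.i ▷ H.X ≫ H.mul := by
  have h := (((L.i ⊗ₘ L.i) ⊗ₘ L.i)) ≫= H.target_mul_mul
  simp only [← tensorHom_id, ← id_tensorHom, tensorHom_comp_tensorHom_assoc,
    associator_naturality_assoc, Category.id_comp, Category.comp_id,
    L.i_comp] at h ⊢
  exact h

/-- The monoid structure on the image of the target morphism. -/
@[reducible]
def targetMonObj (L : Splitting H.target) : MonObj L.obj where
  one := H.one ≫ L.p
  mul := (L.i ⊗ₘ L.i) ≫ H.mul ≫ L.p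
  one_mul := by
    rw [MonoidalCategory.tensorHom_def, Category.assoc, ← comp_whiskerRight_assoc,
      Category.assoc, L.p_i, one_target, ← whisker_exchange_assoc, reassoc_of% H.one_mul,
      leftUnitor_naturality_assoc, L.i_p, Category.comp_id]
  mul_one := by
    rw [MonoidalCategory.tensorHom_def', Category.assoc, ← whiskerLeft_comp_assoc,
      Category.assoc, L.p_i, one_target, whisker_exchange_assoc, reassoc_of% H.mul_one,
      rightUnitor_naturality_assoc, L.i_p, Category.comp_id]
  mul_assoc := by
    have h1 := H.splitting_mul_i L
    have h2 := H.splitting_mul_mul L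
    calc _ = (((L.i ⊗ₘ L.i) ≫ H.mul ≫ L.p) ≫ L.i) ▷ L.obj ≫ H.X ◁ L.i ≫ H.mul ≫ L.p := by
          rw [MonoidalCategory.tensorHom_def L.i L.i]; monoidal
      _ = (α_ _ _ _).hom ≫ L.obj ◁ (((L.i ⊗ₘ L.i) ≫ H.mul ≫ L.p) ≫ L.i) ≫ L.i ▷ H.X ≫
            H.mul ≫ L.p := by
          rw [h1, reassoc_of% h2]
      _ = _ := by rw [MonoidalCategory.tensorHom_def' L.i L.i]; monoidal

end WeakHopfQuasigroup

/-! ### Coinvariants of Hopf modules. -/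

namespace HopfModule
variable {H : WeakHopfQuasigroup C}

theorem act_coact_eq_shuffle (M : HopfModule H) : M.act ≫ M.coact =
    M.coact ▷ H.X ⊗≫ M.X ◁ H.shuffle ⊗≫ M.act ▷ (H.X ⊗ H.X) ⊗≫ M.X ◁ H.mul := by
  rw [M.act_coact, WeakHopfQuasigroup.shuffle]
  simp only [tensorμ, MonoidalCategory.tensorHom_def]
  monoidal

theorem act_eq_counit (M : HopfModule H) : M.act =
    M.coact ▷ H.X ⊗≫ M.X ◁ (H.shuffle ≫ H.X ◁ (H.mul ≫ ε[H.X])) ⊗≫ M.act := by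
  calc M.act = (M.act ≫ M.coact) ≫ M.X ◁ ε[H.X] ≫ (ρ_ M.X).hom := by
        simp [reassoc_of% M.coact_counit]
    _ = M.coact ▷ H.X ⊗≫ M.X ◁ H.shuffle ⊗≫ (M.act ▷ (H.X ⊗ H.X) ≫
        M.X ◁ (H.mul ≫ ε[H.X])) ⊗≫ 𝟙 M.X := by rw [act_coact_eq_shuffle]; monoidal
    _ = _ := by rw [← whisker_exchange]; monoidal

/-- Compatibility of action and coaction, with coassociativity, gives `ρ(q(m)) = m₀ λ(m₂)₁ ⊗ m₁
λ(m₂)₂`. -/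
theorem q_coact (M : HopfModule H) :
    M.q ≫ M.coact = M.coact ≫ M.X ◁ H.antipodeComul ⊗≫ M.act ▷ H.X := by
  calc M.q ≫ M.coact = M.coact ≫ (M.X ◁ H.antipode ≫ M.coact ▷ H.X) ⊗≫ M.X ◁ H.shuffle ⊗≫
        (M.act ▷ (H.X ⊗ H.X) ≫ M.X ◁ H.mul) := by
        rw [q, Category.assoc, Category.assoc, act_coact_eq_shuffle]; monoidal
    _ = (M.coact ≫ M.coact ▷ H.X) ⊗≫ M.X ◁ (H.X ◁ H.antipode ≫ H.shuffle ≫ H.X ◁ H.mul) ⊗≫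
        M.act ▷ H.X := by
        rw [whisker_exchange M.coact H.antipode, ← whisker_exchange M.act H.mul]; monoidal
    _ = _ := by rw [M.coact_coact, WeakHopfQuasigroup.antipodeComul]; monoidal

/-- Morphisms into a Hopf module whose coaction takes values in the image of the target
morphism. -/
def IsCoinvariant (M : HopfModule H) {W : C} (n : W ⟶ M.X) : Prop :=
  n ≫ M.coact ≫ M.X ◁ H.target = n ≫ M.coact

theorem isCoinvariant_q (M : HopfModule H) : M.IsCoinvariant M.q := by
  rw [IsCoinvariant, ← Category.assoc, q_coact]
  calc _ = M.coact ≫ M.X ◁ H.antipodeComul ⊗≫ (M.act ▷ H.X ≫ M.X ◁ H.target) := by monoidal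
    _ = M.coact ≫ M.X ◁ (H.antipodeComul ≫ H.X ◁ H.target) ⊗≫ M.act ▷ H.X := by
        rw [← whisker_exchange]; monoidal
    _ = _ := by rw [H.antipodeComul_target]

namespace IsCoinvariant

variable {M T : HopfModule H} {W : C} {n : W ⟶ M.X}

theorem comp (hn : M.IsCoinvariant n) (g : M ⟶ T) : T.IsCoinvariant (n ≫ g.hom) := by
  unfold IsCoinvariant at hn ⊢
  rw [Category.assoc, reassoc_of% g.colinear, ← whisker_exchange, reassoc_of% hn, Category.assoc,
    g.colinear]

/-- `ρ (n h) = n h₁ ⊗ h₂` for coinvariant `n`. -/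
theorem act_coact (hn : M.IsCoinvariant n) : n ▷ H.X ≫ M.act ≫ M.coact =
    W ◁ Δ[H.X] ⊗≫ (n ▷ H.X ≫ M.act) ▷ H.X := by
  calc n ▷ H.X ≫ M.act ≫ M.coact = (n ≫ M.coact ≫ M.X ◁ H.target) ▷ H.X ⊗≫ M.X ◁ H.shuffle ⊗≫
        (M.act ▷ (H.X ⊗ H.X) ≫ M.X ◁ H.mul) := by
        rw [act_coact_eq_shuffle, hn]; monoidal
    _ = (n ≫ M.coact) ▷ H.X ⊗≫ M.X ◁ (H.target ▷ H.X ≫ H.shuffle ≫ H.X ◁ H.mul) ⊗≫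
        M.act ▷ H.X := by
        rw [← whisker_exchange]; monoidal
    _ = (n ≫ M.coact ≫ M.X ◁ H.target) ▷ H.X ⊗≫ M.X ◁ (H.shuffle ≫ H.X ◁ H.counitMulFst) ⊗≫
        M.act ▷ H.X := by
        rw [H.target_shuffle_mul]; monoidal
    _ = ((n ≫ M.coact) ▷ H.X ≫ (M.X ⊗ H.X) ◁ Δ[H.X]) ⊗≫
        (M.X ◁ (H.shuffle ≫ H.X ◁ (H.mul ≫ ε[H.X])) ⊗≫ M.act) ▷ H.X := by
        rw [hn, H.shuffle_counitMulFst]; monoidal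
    _ = W ◁ Δ[H.X] ⊗≫ (n ▷ H.X ≫ (M.coact ▷ H.X ⊗≫
        M.X ◁ (H.shuffle ≫ H.X ◁ (H.mul ≫ ε[H.X])) ⊗≫ M.act)) ▷ H.X := by
        rw [← whisker_exchange]; monoidal
    _ = _ := by rw [← act_eq_counit]

theorem act_q (hn : M.IsCoinvariant n) :
    n ▷ H.X ≫ M.act ≫ M.q = n ▷ H.X ≫ M.X ◁ H.target ≫ M.act := by
  rw [← M.act_act_antipode]
  calc n ▷ H.X ≫ M.act ≫ M.q = (n ▷ H.X ≫ M.act ≫ M.coact) ≫ M.X ◁ H.antipode ≫ M.act := by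
        rw [q]; simp only [Category.assoc]
    _ = (W ◁ Δ[H.X] ≫ n ▷ (H.X ⊗ H.X)) ⊗≫ M.act ▷ H.X ≫ M.X ◁ H.antipode ≫ M.act := by
        rw [hn.act_coact]; monoidal
    _ = _ := by rw [whisker_exchange, MonoidalCategory.tensorHom_def]; monoidal

/-- The case `h = 1` of `q(n h) = n Π(h)`, since `Π(1) = 1`. -/
theorem comp_q (hn : M.IsCoinvariant n) : n ≫ M.q = n := by
  have h : (ρ_ W).inv ≫ W ◁ H.one ≫ n ▷ H.X ≫ M.act ≫ M.q =
      (ρ_ W).inv ≫ W ◁ H.one ≫ n ▷ H.X ≫ M.act := by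
    rw [hn.act_q, whisker_exchange_assoc, whisker_exchange_assoc, ← whiskerLeft_comp_assoc,
      H.one_target]
  rw [whisker_exchange_assoc, whisker_exchange_assoc, reassoc_of% M.act_one, M.act_one] at h
  simpa using h

theorem coact_eq (hn : M.IsCoinvariant n) : n ≫ M.coact =
    (ρ_ W).inv ≫ W ◁ (H.one ≫ Δ[H.X]) ⊗≫ (n ▷ H.X ≫ M.act) ▷ H.X := by
  calc n ≫ M.coact = (ρ_ W).inv ≫ W ◁ H.one ≫ n ▷ H.X ≫ M.act ≫ M.coact := by
        rw [whisker_exchange_assoc, reassoc_of% M.act_one]; simp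
    _ = _ := by rw [hn.act_coact]; monoidal

/-- Since `ρ(n) = n 1₁ ⊗ 1₂`, the left side is `q(n 1₁)(1₂ h) = (n Π(1₁))(1₂ h)`. Strongness and
`target_mul_mul` turn it into `n ((Π(1₁) 1₂) h)`, and `Π(1₁) 1₂ = 1`. -/
theorem alphaAct (hn : M.IsCoinvariant n) {L : Splitting H.target} (hM : IsStrong L M) :
    n ▷ H.X ≫ M.alphaAct = n ▷ H.X ≫ M.act := by
  -- Strongness precomposed with `p_L`, so that it speaks of `Π` rather than `i_L`.
  have hs : (M.X ◁ H.target ≫ M.act) ▷ H.X ≫ M.act =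
      (α_ M.X H.X H.X).hom ≫ M.X ◁ (H.target ▷ H.X ≫ H.mul) ≫ M.act := by
    have h := (M.X ◁ L.p) ▷ H.X ≫= hM
    have h1 : M.X ◁ H.target = M.X ◁ L.p ≫ M.X ◁ L.i := by rw [← whiskerLeft_comp, L.p_i]
    have h2 : H.target ▷ H.X = L.p ▷ H.X ≫ L.i ▷ H.X := by rw [← comp_whiskerRight, L.p_i]
    calc _ = (M.X ◁ L.p) ▷ H.X ≫ (M.X ◁ L.i ≫ M.act) ▷ H.X ≫ M.act := by
          rw [h1]; monoidal
      _ = _ := by rw [h, h2]; monoidal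
  calc n ▷ H.X ≫ M.alphaAct = (n ≫ M.coact) ▷ H.X ⊗≫ M.q ▷ (H.X ⊗ H.X) ≫ M.X ◁ H.mul ≫
        M.act := by rw [HopfModule.alphaAct, MonoidalCategory.tensorHom_def]; monoidal
    _ = ((ρ_ W).inv ≫ W ◁ (H.one ≫ Δ[H.X])) ▷ H.X ⊗≫ (n ▷ H.X ≫ M.act ≫ M.q) ▷ (H.X ⊗ H.X) ⊗≫
        M.X ◁ H.mul ≫ M.act := by rw [hn.coact_eq]; monoidal
    _ = (((ρ_ W).inv ≫ W ◁ (H.one ≫ Δ[H.X])) ▷ H.X ⊗≫ n ▷ ((H.X ⊗ H.X) ⊗ H.X)) ⊗≫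
        ((M.X ◁ H.target ≫ M.act) ▷ (H.X ⊗ H.X) ≫ M.X ◁ H.mul) ≫ M.act := by
        rw [hn.act_q]; monoidal
    _ = (((ρ_ W).inv ≫ W ◁ (H.one ≫ Δ[H.X])) ▷ H.X ⊗≫ n ▷ ((H.X ⊗ H.X) ⊗ H.X)) ⊗≫
        (M.X ⊗ H.X) ◁ H.mul ⊗≫ ((M.X ◁ H.target ≫ M.act) ▷ H.X ≫ M.act) := by
        rw [← whisker_exchange]; monoidal
    _ = (((ρ_ W).inv ≫ W ◁ (H.one ≫ Δ[H.X])) ▷ H.X ⊗≫ n ▷ ((H.X ⊗ H.X) ⊗ H.X)) ⊗≫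
        M.X ◁ ((α_ H.X H.X H.X).hom ≫ H.X ◁ H.mul ≫ H.target ▷ H.X ≫ H.mul) ≫ M.act := by
        rw [hs]; monoidal
    _ = (((ρ_ W).inv ≫ W ◁ (H.one ≫ Δ[H.X])) ▷ H.X ⊗≫
        (n ▷ ((H.X ⊗ H.X) ⊗ H.X) ≫
        M.X ◁ ((H.target ▷ H.X ≫ H.mul) ▷ H.X ≫ H.mul)) ≫ M.act) := by
        rw [← H.target_mul_mul]; monoidal
    _ = ((ρ_ W).inv) ▷ H.X ⊗≫ W ◁ ((H.one ≫ Δ[H.X] ≫ H.target ▷ H.X ≫ H.mul) ▷ H.X ≫ H.mul) ⊗≫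
        n ▷ H.X ≫ M.act := by
        rw [← whisker_exchange]; monoidal
    _ = _ := by
        rw [H.comul_target_mul, Category.comp_id, H.one_mul]; monoidal

end IsCoinvariant

/-! ### The `H_L`-module of coinvariants and its functoriality. -/

variable {M T : HopfModule H} {L : Splitting H.target}

theorem isCoinvariant_splitting (S : Splitting M.q) : M.IsCoinvariant S.i := by
  have h := S.i ≫= M.isCoinvariant_q
  rwa [← Category.assoc, ← Category.assoc S.i, S.i_comp] at h

/-- The projection `p_M` in the action loses nothing: `q(n z) = n Π(z) = n z` for coinvariant `n`
and `z` in `H_L`. -/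
theorem coinvAct_i (L : Splitting H.target) (S : Splitting M.q) :
    M.coinvAct L S ≫ S.i = (S.i ⊗ₘ L.i) ≫ M.act := by
  rw [coinvAct, Category.assoc, Category.assoc, S.p_i, MonoidalCategory.tensorHom_def',
    Category.assoc, (isCoinvariant_splitting S).act_q, whisker_exchange_assoc,
    ← whiskerLeft_comp_assoc, L.i_comp, Category.assoc, whisker_exchange_assoc]

theorem isRightAction_coinvAct (hM : IsStrong L M) (S : Splitting M.q) :
    let _ := H.targetMonObj L
    IsRightAction L.obj S.obj (M.coinvAct L S) := by
  let _ := H.targetMonObj L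
  have h1 := coinvAct_i L S
  have h2 := H.splitting_mul_i L
  refine ⟨?_, ?_⟩
  · change S.obj ◁ (H.one ≫ L.p) ≫ (S.i ⊗ₘ L.i) ≫ M.act ≫ S.p = _
    rw [MonoidalCategory.tensorHom_def', Category.assoc, ← whiskerLeft_comp_assoc,
      Category.assoc, L.p_i, H.one_target, whisker_exchange_assoc, reassoc_of% M.act_one,
      rightUnitor_naturality_assoc, S.i_p, Category.comp_id]
  · change (α_ _ _ _).hom ≫ S.obj ◁ ((L.i ⊗ₘ L.i) ≫ H.mul ≫ L.p) ≫ (S.i ⊗ₘ L.i) ≫ M.act ≫ S.p =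
      M.coinvAct L S ▷ L.obj ≫ (S.i ⊗ₘ L.i) ≫ M.act ≫ S.p
    symm
    calc _ = (M.coinvAct L S ≫ S.i) ▷ L.obj ≫ M.X ◁ L.i ≫ M.act ≫ S.p := by
          rw [MonoidalCategory.tensorHom_def]; monoidal
      _ = (S.i ▷ L.obj) ▷ L.obj ≫ ((M.X ◁ L.i ≫ M.act) ▷ L.obj ≫ M.X ◁ L.i) ≫ M.act ≫ S.p := by
          rw [h1, MonoidalCategory.tensorHom_def]; monoidal
      _ = ((S.i ▷ L.obj) ▷ L.obj ≫ (M.X ⊗ L.obj) ◁ L.i) ≫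
            ((M.X ◁ L.i ≫ M.act) ▷ H.X ≫ M.act) ≫ S.p := by
          rw [← whisker_exchange]; simp only [Category.assoc]
      _ = (α_ _ _ _).hom ≫ (S.i ▷ (L.obj ⊗ L.obj) ≫ M.X ◁ ((L.i ⊗ₘ L.i) ≫ H.mul)) ≫
            M.act ≫ S.p := by
          rw [hM, MonoidalCategory.tensorHom_def']; monoidal
      _ = _ := by
          rw [← whisker_exchange, ← h2, MonoidalCategory.tensorHom_def' S.i L.i]; monoidal

/-- The morphism induced on coinvariants. -/
def coinvMap (S : Splitting M.q) (S' : Splitting T.q) (g : M ⟶ T) : S.obj ⟶ S'.obj :=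
  S.i ≫ g.hom ≫ S'.p

theorem coinvMap_i (S : Splitting M.q) (S' : Splitting T.q) (g : M ⟶ T) :
    coinvMap S S' g ≫ S'.i = S.i ≫ g.hom := by
  rw [coinvMap, Category.assoc, Category.assoc, S'.p_i, ← Category.assoc,
    ((isCoinvariant_splitting S).comp g).comp_q]

/-- Quasilinearity concerns `alphaAct`. Both `n` and `g(n)` are coinvariant in strong modules, so
there it reads `g(n z) = g(n) z` for the original actions. -/
theorem coinvMap_linear (hM : IsStrong L M) (hT : IsStrong L T) (S : Splitting M.q)
    (S' : Splitting T.q) (g : M ⟶ T) :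
    coinvMap S S' g ▷ L.obj ≫ T.coinvAct L S' = M.coinvAct L S ≫ coinvMap S S' g := by
  have hS := isCoinvariant_splitting S
  apply Splitting.hom_ext S'
  rw [Category.assoc, Category.assoc, coinvMap_i, coinvAct_i, reassoc_of% coinvAct_i L S,
    MonoidalCategory.tensorHom_def, MonoidalCategory.tensorHom_def', Category.assoc,
    Category.assoc, ← comp_whiskerRight_assoc, coinvMap_i, ← whisker_exchange_assoc,
    (hS.comp g).alphaAct hT |>.symm, comp_whiskerRight_assoc, g.quasilinear,
    reassoc_of% hS.alphaAct hM]

end HopfModule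

end

theorem proposition3p8 {C : Type u} [Category.{v} C] [MonoidalCategory C] [BraidedCategory C]
    [IsIdempotentComplete C] (H : WeakHopfQuasigroup C) :
    -- the images `H_L` and `M^{coH}` exist
    H.target ≫ H.target = H.target ∧
    (∀ M : HopfModule H, M.q ≫ M.q = M.q) ∧
    -- for every choice of these images
    ∀ (L : Splitting H.target) (S : ∀ M : StrongHopfModule H L, Splitting M.obj.q),
      -- `H_L` is a monoid
      ∃ monL : MonObj L.obj,
        monL.one = H.one ≫ L.p ∧ monL.mul = (L.i ⊗ₘ L.i) ≫ H.mul ≫ L.p ∧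
        -- `M^{coH}` is a right `H_L`-module
        ∃ hact : ∀ M, IsRightAction L.obj (S M).obj (M.obj.coinvAct L (S M)),
          -- `g^{coH}` is well defined
          (∀ {M T : StrongHopfModule H L} (g : M ⟶ T),
            ∃! gco : (S M).obj ⟶ (S T).obj, gco ≫ (S T).i = (S M).i ≫ g.hom.hom) ∧
          -- the functor of coinvariants
          ∃ (G : StrongHopfModule H L ⥤ RightModule L.obj)
            (hobj : ∀ M, G.obj M = ⟨(S M).obj, M.obj.coinvAct L (S M), hact M⟩),
            ∀ {M T : StrongHopfModule H L} (g : M ⟶ T),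
              (eqToHom (hobj M).symm ≫ G.map g ≫ eqToHom (hobj T)).hom ≫ (S T).i =
                (S M).i ≫ g.hom.hom := by
  refine ⟨H.target_target, fun M => M.isCoinvariant_q.comp_q, fun L S => ?_⟩
  let monL := H.targetMonObj L
  have hact : ∀ M : StrongHopfModule H L,
      IsRightAction L.obj (S M).obj (M.obj.coinvAct L (S M)) :=
    fun M => HopfModule.isRightAction_coinvAct M.property (S M)
  refine ⟨monL, rfl, rfl, hact, fun {M T} g => ⟨HopfModule.coinvMap (S M) (S T) g.hom,
    HopfModule.coinvMap_i _ _ _, fun f hf => Splitting.hom_ext (S T) ?_⟩, ?_⟩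
  · rw [hf, HopfModule.coinvMap_i]
  · refine ⟨
      { obj := fun M => ⟨(S M).obj, M.obj.coinvAct L (S M), hact M⟩
        map := fun {M T} g => ⟨HopfModule.coinvMap (S M) (S T) g.hom,
          HopfModule.coinvMap_linear M.property T.property _ _ _⟩
        map_id := fun M => RightModule.Hom.ext (Splitting.hom_ext (S M) ?_)
        map_comp := fun {M N T} f g => RightModule.Hom.ext (Splitting.hom_ext (S T) ?_) },
      fun M => rfl, fun {M T} g => ?_⟩
    · refine (HopfModule.coinvMap_i _ _ _).trans ?_
      exact (Category.comp_id _).trans (Category.id_comp _).symm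
    · refine (HopfModule.coinvMap_i _ _ _).trans ?_
      change (S M).i ≫ f.hom.hom ≫ g.hom.hom =
        (HopfModule.coinvMap (S M) (S N) f.hom ≫ HopfModule.coinvMap (S N) (S T) g.hom) ≫ (S T).i
      rw [Category.assoc, HopfModule.coinvMap_i, reassoc_of% HopfModule.coinvMap_i]
    -- The object equalities hold definitionally, so the transports are identities.
    · simp only [eqToHom_refl, Category.id_comp, Category.comp_id]
      exact HopfModule.coinvMap_i _ _ _
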